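/- **Conventions.** All spaces are convenient in Steenrod's sense (compactly generated Hausdorff), and products and mapping spaces are formed in that category. For a space $X$, let $\mathcal{P}(X)$ be the set of probability measures on $X$ with finite support, with the quotient topology coming from the maps $X^m\times\Delta^{m-1}\to\mathcal{P}(X)$, $(x,t)\mapsto\sum_{i=1}^m t_i\delta_{x_i}$, $m\ge 0$. For a map $f:X\to Y$, let $\mathcal{P}_m(f)\subseteq\mathcal{P}(X)$ be the subspace of those measures whose support has at most $m$ points and lies in a single fibre of $f$; sending a measure to the point in whose fibre it is supported defines a map $\mathcal{P}_m(f)\to Y$. For a space $X$ with basepoint $x_0$, the analog category of $X$ is the least $n$ such that $\mathcal{P}_{n+1}(\mathrm{ev})\to X$ admits a continuous section, where $\mathrm{ev}:(X,x_0)^{([0,1],\{0\})}\to X$ is evaluation at $1$ on the space of paths in $X$ starting at $x_0$. For a discrete group $G$, let $BG$ be the geometric realization of the nerve of $G$, and let $EG$ be its universal cover with $G$ acting by deck transformations, in its standard model: the geometric realization of the simplicial set whose $k$-simplices are the $(k+1)$-tuples of elements of $G$, on which $G$ acts by left translation of all entries. Let $\mathrm{acat}(G)$ be the analog category of $BG$.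 For a $G$-space $X$, write $X^{hG}=\mathrm{Map}^G(EG,X)$ for the space of continuous $G$-equivariant maps $EG\to X$ (the homotopy fixed point space). Let $\Delta_n^G$ be the $n$-skeleton of the simplex with vertex set $G$, with its weak (CW) topology and the $G$-action induced by left translation of the vertices; thus its points are given by barycentric coordinates indexed by $G$, at most $n+1$ of them nonzero. **Proposition.** For every group $G$ and every choice of basepoint of $BG$, $$\mathrm{acat}(G)=\min\{n\ge 0\mid (\Delta_n^G)^{hG}\neq\varnothing\},$$ where both sides are $\infty$ if no such $n$ exists. -/

import Mathlib

universe u v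

open CategoryTheory Convexity

noncomputable section

namespace AnalogCategory

/-! ### Finitely supported probability measures -/

/-- The formal convex combination `∑ᵢ tᵢ δ_{xᵢ}`: the family `x` is indexed by a finite type and
`t` is a point of the standard topological simplex on that type. -/
def convexSum {ι : Type*} [Fintype ι] {X : Type*} (x : ι → X) (t : stdSimplex ℝ ι) :
    StdSimplex ℝ X :=
  StdSimplex.map x
    { weights := Finsupp.equivFunOnFinite.symm (t : ι → ℝ)
      nonneg := fun i => t.2.1 i
      total := by
        rw [Finsupp.sum_fintype _ _ (fun _ => rfl)]
        exact t.2.2 }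

/-- The set `𝒫(X)` of probability measures with finite support on `X`. Such a measure is given by
its weights: a finitely supported function `X → ℝ` with nonnegative values and sum `1`. -/
def FinProb (X : Type*) : Type _ := StdSimplex ℝ X

/-- The (finite) support of a measure in `𝒫(X)`. -/
def FinProb.support {X : Type*} (μ : FinProb X) : Finset X :=
  (StdSimplex.weights μ).support

theorem FinProb.support_nonempty {X : Type*} (μ : FinProb X) : μ.support.Nonempty :=
  StdSimplex.support_weights_nonempty μ

/-- The quotient topology on `𝒫(X)`: the finest topology for which all the maps
`Xⁿ × Δⁿ⁻¹ → 𝒫(X)`, `(x, t) ↦ ∑ᵢ tᵢ δ_{xᵢ}`, are continuous. The product `Xⁿ × Δⁿ⁻¹` is the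
product of convenient (compactly generated Hausdorff) spaces, that is, the k-ification of the
ordinary product. -/
instance {X : Type*} [TopologicalSpace X] : TopologicalSpace (FinProb X) :=
  ⨆ n : ℕ, TopologicalSpace.coinduced
    (fun p : CompactCoherentification ((Fin n → X) × stdSimplex ℝ (Fin n)) =>
      convexSum ((CompactCoherentification.mk _).symm p).1
        ((CompactCoherentification.mk _).symm p).2)
    inferInstance

/-- The space `𝒫ₙ(f)` of the measures on `X` whose support has at most `n` points and lies in a
single fibre of `f : X → Y`, as a subspace of `𝒫(X)`. -/
def FibFinProb {X Y : Type*} (f : X → Y) (n : ℕ) : Type _ :=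
  {μ : FinProb X // μ.support.card ≤ n ∧ ∀ x ∈ μ.support, ∀ x' ∈ μ.support, f x = f x'}

instance {X Y : Type*} [TopologicalSpace X] (f : X → Y) (n : ℕ) :
    TopologicalSpace (FibFinProb f n) :=
  inferInstanceAs (TopologicalSpace {μ : FinProb X //
    μ.support.card ≤ n ∧ ∀ x ∈ μ.support, ∀ x' ∈ μ.support, f x = f x'})

/-- The map `𝒫ₙ(f) → Y` sending a measure to the point in whose fibre it is supported. -/
def FibFinProb.proj {X Y : Type*} {f : X → Y} {n : ℕ} (μ : FibFinProb f n) : Y :=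
  f μ.1.support_nonempty.choose

theorem FibFinProb.proj_eq {X Y : Type*} {f : X → Y} {n : ℕ} (μ : FibFinProb f n) {x : X}
    (hx : x ∈ μ.1.support) : μ.proj = f x :=
  μ.2.2 _ μ.1.support_nonempty.choose_spec _ hx

/-! ### Analog sectional category and analog category -/

/-- The least natural number satisfying `p`, and `∞` if there is none. -/
def least (p : ℕ → Prop) : ℕ∞ := ⨅ (n : ℕ) (_ : p n), (n : ℕ∞)

/-- The analog sectional category of `f : X → Y`: the least `n` such that `𝒫ₙ₊₁(f) → Y` admits a
(continuous) section. -/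
def analogSecat {X Y : Type*} [TopologicalSpace X] [TopologicalSpace Y] (f : X → Y) : ℕ∞ :=
  least fun n => ∃ s : C(Y, FibFinProb f (n + 1)), ∀ y, (s y).proj = y

/-- The space `(X, x₀)^([0,1], {0})` of paths in `X` starting at `x₀`, as a convenient space: the
k-ification of the compact-open topology. -/
abbrev BasedPaths (X : Type*) [TopologicalSpace X] (x₀ : X) : Type _ :=
  CompactCoherentification {γ : C(unitInterval, X) // γ 0 = x₀}

/-- The evaluation of a path at its endpoint. -/
def endpoint {X : Type*} [TopologicalSpace X] {x₀ : X} (γ : BasedPaths X x₀) : X :=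
  ((CompactCoherentification.mk _).symm γ).1 1

/-- The analog category of the space `X`, computed with the basepoint `x₀`. -/
def acat (X : Type*) [TopologicalSpace X] (x₀ : X) : ℕ∞ :=
  analogSecat (endpoint : BasedPaths X x₀ → X)

/-! ### Classifying spaces and homotopy fixed points -/

/-- The classifying space of the discrete group `G`: the geometric realization of the nerve of
`G`, viewed as a category with one object. -/
def BG (G : Type u) [Group G] : Type u :=
  (SSet.toTop.obj (nerve (SingleObj G)) : TopCat.{u})

instance (G : Type u) [Group G] : TopologicalSpace (BG G) :=
  inferInstanceAs (TopologicalSpace (SSet.toTop.obj (nerve (SingleObj G)) : TopCat.{u}))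

/-- The universal cover of the nerve of `G`, as a simplicial set: its `n`-simplices are the
`(n + 1)`-tuples in `G`, and simplicial operators act by reindexing. -/
def simplicialEG (G : Type u) [Group G] : SSet.{u} :=
  classifyingSpaceUniversalCover G ⋙ Action.forget (Type u) G

/-- The translation by `g` on tuples, `(g₀, …, gₙ) ↦ (g g₀, …, g gₙ)`. -/
def translation (G : Type u) [Group G] (g : G) : simplicialEG G ⟶ simplicialEG G where
  app n := ((classifyingSpaceUniversalCover G).obj n).ρ g
  naturality _ _ f := ((classifyingSpaceUniversalCover G).map f).comm g

theorem translation_one (G : Type u) [Group G] : translation G 1 = 𝟙 _ := by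
  ext n x
  exact one_smul G (α := Fin (n.unop.len + 1) → G) x

theorem translation_mul (G : Type u) [Group G] (g h : G) :
    translation G (g * h) = translation G h ≫ translation G g := by
  ext n x
  exact mul_smul (β := Fin (n.unop.len + 1) → G) g h x

/-- The space `EG`, the standard model of the universal cover of `BG`: the geometric realization
of the universal cover of the nerve of `G`. The simplicial set of tuples is contractible, `G` acts
freely on it by translation, and the orbits are the simplices of the nerve of `G`, the class of
`(g₀, …, gₙ)` being the chain of the arrows `gᵢ⁻¹ gᵢ₋₁`. -/
def EG (G : Type u) [Group G] : Type u :=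
  (SSet.toTop.obj (simplicialEG G) : TopCat.{u})

instance (G : Type u) [Group G] : TopologicalSpace (EG G) :=
  inferInstanceAs (TopologicalSpace (SSet.toTop.obj (simplicialEG G) : TopCat.{u}))

/-- The action of `G` on `EG` by deck transformations, induced by translation of tuples. -/
instance (G : Type u) [Group G] : MulAction G (EG G) where
  smul g e := (SSet.toTop.map (translation G g)).hom e
  one_smul e := by
    change (SSet.toTop.map (translation G 1)).hom e = e
    rw [translation_one, CategoryTheory.Functor.map_id]
    rfl
  mul_smul g h e := by
    change (SSet.toTop.map (translation G (g * h))).hom e =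
      (SSet.toTop.map (translation G g)).hom ((SSet.toTop.map (translation G h)).hom e)
    rw [translation_mul, CategoryTheory.Functor.map_comp]
    rfl

/-- The space `X^{hG} = Map^G(EG, X)` of homotopy fixed points of the `G`-space `X`: the space of
continuous `G`-equivariant maps `EG → X`, as a convenient space. -/
abbrev HomotopyFixedPoints (G : Type u) [Group G] (X : Type v) [TopologicalSpace X]
    [MulAction G X] : Type (max u v) :=
  CompactCoherentification {φ : C(EG G, X) // ∀ (g : G) (e : EG G), φ (g • e) = g • φ e}

/-! ### Skeleta of the simplex on a set of vertices -/

/-- The `n`-skeleton of the simplex on the vertex set `V`: its points are given by their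
barycentric coordinates, at most `n + 1` of which are nonzero. -/
def SimplexSkeleton (V : Type v) (n : ℕ) : Type v :=
  {w : StdSimplex ℝ V // w.weights.support.card ≤ n + 1}

theorem card_support_convexSum_le {V : Type v} (s : Finset V) (t : stdSimplex ℝ s) :
    (convexSum ((↑) : s → V) t).weights.support.card ≤ s.card := by
  classical
  refine Finset.card_le_card fun v hv => ?_
  obtain ⟨a, -, rfl⟩ := Finset.mem_image.mp (Finsupp.mapDomain_support hv)
  exact a.2

/-- The inclusion into the `n`-skeleton of the closed face spanned by a set `s` of at most `n + 1`
vertices. -/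
def faceInclusion {V : Type v} {n : ℕ} (s : {s : Finset V // s.card ≤ n + 1})
    (t : stdSimplex ℝ s.1) : SimplexSkeleton V n :=
  ⟨convexSum (↑) t, (card_support_convexSum_le s.1 t).trans s.2⟩

/-- The weak (CW) topology: a set is open if and only if its intersection with each closed face
is open in that face. -/
instance (V : Type v) (n : ℕ) : TopologicalSpace (SimplexSkeleton V n) :=
  ⨆ s : {s : Finset V // s.card ≤ n + 1},
    TopologicalSpace.coinduced (faceInclusion s) inferInstance

theorem card_support_map_le {V : Type v} (f : V → V) (w : StdSimplex ℝ V) :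
    (w.map f).weights.support.card ≤ w.weights.support.card := by
  classical
  exact (Finset.card_le_card Finsupp.mapDomain_support).trans Finset.card_image_le

/-- The action of `G` on the `n`-skeleton of the simplex on `G`, induced by left translation of
the vertices. -/
instance (G : Type u) [Group G] (n : ℕ) : MulAction G (SimplexSkeleton G n) where
  smul g w := ⟨w.1.map (fun x => g * x), (card_support_map_le _ w.1).trans w.2⟩
  one_smul w := by
    refine Subtype.ext ?_
    change w.1.map (fun x => 1 * x) = w.1
    simp only [one_mul]
    exact w.1.map_id
  mul_smul g h w := by
    refine Subtype.ext ?_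
    change w.1.map (fun x => g * h * x) = (w.1.map (fun x => h * x)).map (fun x => g * x)
    rw [← StdSimplex.map_comp]
    simp only [Function.comp_def, mul_assoc]

end AnalogCategory

end

/-!
The projection `EG → BG` is the quotient of the contractible space `EG` by the free and properly
discontinuous action of `G`, hence a covering map. Over this covering, the points of a fibre of the
endpoint map on based paths can be traded for elements of `G`, in both directions.

*From sections to equivariant maps.* A path in `BG` from the base point has a lift to `EG` with a
fixed initial point, and the endpoint of the lift depends continuously on the path
(`exists_lift_endpoint`). Let a section choose the measure `∑ tᵢ δ_{γᵢ}` over the image of `e`.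
The lift of `γᵢ` ends at `gᵢ⁻¹ e` for a unique `gᵢ`, and `e ↦ ∑ tᵢ gᵢ` is equivariant
(`sectionToSkeleton_smul`). For continuity (`continuous_sectionToSkeleton`), each coordinate is
near any `e₀` the expected value of a bump function on the space of paths; these bump functions
form a locally finite family, which is what continuity for the weak topology of the skeleton needs
(`isClosed_expect`). Indicator functions of sets of paths would not do, since they are not
continuous on the space of all paths.

*From equivariant maps to sections.* Coning off with the vertex `1` contracts `EG`, and gives a path
`Γ(e)` in `BG` from the base point to the image of `e`, continuously in `e`
(`exists_continuous_basedPaths`). For an equivariant `φ`, the measure `∑ φ(e)_g δ_{Γ(g⁻¹ e)}`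
depends only on the orbit of `e` (`pathMeasure_smul`), and continuously on `e` (`continuous_pathMeasure`).

*The covering.* That the translates of a point of `EG` are uniformly separated is seen from a map
from `EG` to the step functions `(0, 1] → G`: the point with coordinates `(t₀, …, tₖ)` in the
simplex `(g₀, …, gₖ)` goes to the function with the values `gᵢ` on consecutive intervals of lengths
`tᵢ`. The measure of the set where two step functions differ is a continuous
pseudometric on `EG`, for which `g e` and `e` have distance `1` whenever `g ≠ 1`
(`stepDist_smul_self`, `isQuotientCoveringMap_projBG`).

All maps out of geometric realizations are glued from compatible maps on simplices by means of the
adjunction with the singular simplicial set (`SimplexFamily.desc`, `continuous_realization_iff`).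
-/

noncomputable section

namespace AnalogCategory

open Topology MeasureTheory

/-! ### Geometric realizations -/

section

variable {X Y : SSet.{u}}

/-- The points of the geometric realization of `X`, as a type. -/
abbrev Realization (X : SSet.{u}) : Type u := (SSet.toTop.obj X : TopCat.{u})

/-- The map `Δⁿ → |X|` attached to an `n`-simplex of `X`. -/
def simplexMap {n : SimplexCategoryᵒᵖ} (x : X.obj n) :
    C(stdSimplex ℝ (Fin (n.unop.len + 1)), Realization X) :=
  TopCat.toSSetObjEquiv _ n (sSetTopAdj.unit.app X |>.app n x)

theorem toSSetObjEquiv_map_left (Z : TopCat.{u}) {n m : SimplexCategoryᵒᵖ} (θ : n ⟶ m)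
    (s : (TopCat.toSSet.obj Z).obj n) (t : stdSimplex ℝ (Fin (m.unop.len + 1))) :
    TopCat.toSSetObjEquiv Z m ((TopCat.toSSet.obj Z).map θ s) t =
      TopCat.toSSetObjEquiv Z n s (stdSimplex.map θ.unop t) :=
  rfl

theorem toSSetObjEquiv_map_right {Z W : TopCat.{u}} (f : Z ⟶ W) {n : SimplexCategoryᵒᵖ}
    (s : (TopCat.toSSet.obj Z).obj n) (t : stdSimplex ℝ (Fin (n.unop.len + 1))) :
    TopCat.toSSetObjEquiv W n ((TopCat.toSSet.map f).app n s) t =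
      f.hom (TopCat.toSSetObjEquiv Z n s t) :=
  rfl

theorem simplexMap_map {n m : SimplexCategoryᵒᵖ} (θ : n ⟶ m) (x : X.obj n)
    (t : stdSimplex ℝ (Fin (m.unop.len + 1))) :
    simplexMap (X.map θ x) t = simplexMap x (stdSimplex.map θ.unop t) := by
  unfold simplexMap
  rw [← toSSetObjEquiv_map_left]
  have h : (sSetTopAdj.unit.app X).app m (X.map θ x) =
      (TopCat.toSSet.obj (SSet.toTop.obj X)).map θ ((sSetTopAdj.unit.app X).app n x) :=
    congr($((sSetTopAdj.unit.app X).naturality θ) x)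
  exact congr(TopCat.toSSetObjEquiv _ m $h t)

theorem realization_map_simplexMap (f : X ⟶ Y) {n : SimplexCategoryᵒᵖ} (x : X.obj n)
    (t : stdSimplex ℝ (Fin (n.unop.len + 1))) :
    (SSet.toTop.map f).hom (simplexMap x t) = simplexMap (f.app n x) t := by
  unfold simplexMap
  rw [← toSSetObjEquiv_map_right]
  congr 2
  have := sSetTopAdj.unit.naturality f
  exact (congr($(this).app n x)).symm

/-- A family of maps `Δⁿ → Z` indexed by the simplices of `X`, compatible with the simplicial
operators. -/
structure SimplexFamily (X : SSet.{u}) (Z : Type u) [TopologicalSpace Z] where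
  /-- The map attached to a simplex. -/
  toFun : ∀ {n : SimplexCategoryᵒᵖ}, X.obj n → C(stdSimplex ℝ (Fin (n.unop.len + 1)), Z)
  /-- The compatibility with the simplicial operators. -/
  map : ∀ {n m : SimplexCategoryᵒᵖ} (θ : n ⟶ m) (x : X.obj n)
    (t : stdSimplex ℝ (Fin (m.unop.len + 1))),
    toFun (X.map θ x) t = toFun x (stdSimplex.map θ.unop t)

/-- The simplicial map to the singular set which corresponds to a compatible family. -/
def SimplexFamily.toSSetHom {Z : Type u} [TopologicalSpace Z] (F : SimplexFamily X Z) :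
    X ⟶ TopCat.toSSet.obj (TopCat.of Z) where
  app n := ↾fun x => (TopCat.toSSetObjEquiv (TopCat.of Z) n).symm (F.toFun x)
  naturality n m θ := by
    ext x
    apply (TopCat.toSSetObjEquiv (TopCat.of Z) m).injective
    ext t
    refine Eq.trans ?_ (toSSetObjEquiv_map_left (TopCat.of Z) θ _ t).symm
    exact F.map θ x t

/-- The map `|X| → Z` glued from a compatible family of maps on the simplices. -/
def SimplexFamily.desc {Z : Type u} [TopologicalSpace Z] (F : SimplexFamily X Z) :
    C(Realization X, Z) :=
  ((sSetTopAdj.homEquiv X (TopCat.of Z)).symm F.toSSetHom).hom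

theorem SimplexFamily.desc_simplexMap {Z : Type u} [TopologicalSpace Z] (F : SimplexFamily X Z)
    {n : SimplexCategoryᵒᵖ} (x : X.obj n) (t : stdSimplex ℝ (Fin (n.unop.len + 1))) :
    F.desc (simplexMap x t) = F.toFun x t := by
  have h := (sSetTopAdj.homEquiv X (TopCat.of Z)).apply_symm_apply F.toSSetHom
  rw [Adjunction.homEquiv_unit] at h
  have h2 := congr(TopCat.toSSetObjEquiv (TopCat.of Z) n ($(h).app n x) t)
  refine Eq.trans ?_ (h2.trans ?_)
  · rfl
  · simp [toSSetHom]

/-- Two continuous maps out of a geometric realization agree if they agree on all simplices. -/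
theorem realization_hom_ext {Z : Type u} [TopologicalSpace Z] {f g : C(Realization X, Z)}
    (h : ∀ {n : SimplexCategoryᵒᵖ} (x : X.obj n) t, f (simplexMap x t) = g (simplexMap x t)) :
    f = g := by
  have : (TopCat.ofHom f : SSet.toTop.obj X ⟶ TopCat.of Z) = TopCat.ofHom g := by
    apply (sSetTopAdj.homEquiv X (TopCat.of Z)).injective
    rw [Adjunction.homEquiv_unit, Adjunction.homEquiv_unit]
    ext n x
    apply (TopCat.toSSetObjEquiv (TopCat.of Z) n).injective
    ext t
    exact h x t
  exact congr(TopCat.Hom.hom $this)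

/-- Every point of `|X|` lies in a simplex: the maps from the simplices glue to a retraction of `|X|`
onto the union of their images. -/
theorem exists_simplexMap_eq (e : Realization X) :
    ∃ (n : SimplexCategoryᵒᵖ) (x : X.obj n) (t : _), simplexMap x t = e := by
  let S : Set (Realization X) :=
    {e | ∃ (n : SimplexCategoryᵒᵖ) (x : X.obj n) (t : _), simplexMap x t = e}
  let F : SimplexFamily X S :=
    { toFun := fun x => ⟨fun t => ⟨simplexMap x t, _, x, t, rfl⟩, by fun_prop⟩
      map := fun θ x t => Subtype.ext (simplexMap_map θ x t) }
  have h : (⟨Subtype.val, continuous_subtype_val⟩ : C(S, Realization X)).comp F.desc = .id _ :=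
    realization_hom_ext fun x t => congr(($(F.desc_simplexMap x t)).1)
  have h2 := congr($h e)
  rw [← show (F.desc e).1 = e from h2]
  exact (F.desc e).2

/-- The realization of `X`, with the finest topology for which the maps from the simplices of `X`
are continuous. -/
def FineRealization (X : SSet.{u}) : Type u := Realization X

instance : TopologicalSpace (FineRealization X) :=
  ⨆ (n : SimplexCategoryᵒᵖ) (x : X.obj n),
    TopologicalSpace.coinduced (fun t => (simplexMap x t : Realization X)) inferInstance

theorem continuous_fineRealization_iff {Z : Type*} [TopologicalSpace Z]
    {f : FineRealization X → Z} :
    Continuous f ↔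
      ∀ {n : SimplexCategoryᵒᵖ} (x : X.obj n), Continuous fun t => f (simplexMap x t) := by
  refine continuous_iSup_dom.trans (forall_congr' fun n => ?_)
  exact continuous_iSup_dom.trans (forall_congr' fun x => continuous_coinduced_dom)

/-- A map out of a geometric realization is continuous if it is continuous on every simplex. -/
theorem continuous_realization_iff {Z : Type*} [TopologicalSpace Z] {f : Realization X → Z} :
    Continuous f ↔
      ∀ {n : SimplexCategoryᵒᵖ} (x : X.obj n), Continuous fun t => f (simplexMap x t) := by
  refine ⟨fun h n x => h.comp (simplexMap x).continuous, fun h => ?_⟩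
  -- The identity `|X| → |X|` is continuous for the fine topology on the target, since it is glued
  -- from the maps `Δⁿ → |X|`.
  let F : SimplexFamily X (FineRealization X) :=
    { toFun := fun x => ⟨fun t => (simplexMap x t : Realization X),
        continuous_fineRealization_iff.1 continuous_id x⟩
      map := fun θ x t => simplexMap_map θ x t }
  let i : C(FineRealization X, Realization X) :=
    ⟨id, continuous_fineRealization_iff.2 fun x => (simplexMap x).continuous⟩
  have hi : i.comp F.desc = .id _ := realization_hom_ext fun x t => F.desc_simplexMap x t
  have hf : Continuous (f ∘ F.desc) := (continuous_fineRealization_iff.2 h).comp F.desc.continuous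
  convert hf using 1
  ext e
  exact congr(f $(DFunLike.congr_fun hi e)).symm

end

/-! ### The projection from `EG` to `BG` -/

section

variable {G : Type u} [Group G]

/-- The map `Δⁿ → EG` attached to an `(n + 1)`-tuple in `G`. -/
def tupleMap {n : SimplexCategoryᵒᵖ} (x : Fin (n.unop.len + 1) → G) :
    C(stdSimplex ℝ (Fin (n.unop.len + 1)), EG G) :=
  simplexMap (X := simplicialEG G) x

theorem tupleMap_comp {n m : SimplexCategoryᵒᵖ} (θ : n ⟶ m) (x : Fin (n.unop.len + 1) → G)
    (t : stdSimplex ℝ (Fin (m.unop.len + 1))) :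
    tupleMap (fun i => x (θ.unop i)) t = tupleMap x (stdSimplex.map θ.unop t) :=
  simplexMap_map (X := simplicialEG G) θ x t

theorem smul_tupleMap (g : G) {n : SimplexCategoryᵒᵖ} (x : Fin (n.unop.len + 1) → G)
    (t : stdSimplex ℝ (Fin (n.unop.len + 1))) : g • tupleMap x t = tupleMap (g • x) t :=
  realization_map_simplexMap (translation G g) x t

theorem exists_tupleMap_eq (e : EG G) :
    ∃ (n : SimplexCategoryᵒᵖ) (x : Fin (n.unop.len + 1) → G) (t : _), tupleMap x t = e :=
  exists_simplexMap_eq (X := simplicialEG G) e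

theorem continuous_EG_iff {Z : Type*} [TopologicalSpace Z] {f : EG G → Z} :
    Continuous f ↔ ∀ {n : SimplexCategoryᵒᵖ} (x : Fin (n.unop.len + 1) → G),
      Continuous fun t => f (tupleMap x t) :=
  continuous_realization_iff (X := simplicialEG G)

instance : ContinuousConstSMul G (EG G) where
  continuous_const_smul g := (SSet.toTop.map (translation G g)).hom.continuous

/-- The projection of the universal cover of the nerve of `G`: the tuple `(g₀, …, gₙ)` is sent to
the chain of the arrows `gⱼ⁻¹ gᵢ`. -/
def toNerve (G : Type u) [Group G] : simplicialEG G ⟶ nerve (SingleObj G) where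
  app n := ↾fun (x : Fin (n.unop.len + 1) → G) =>
    ({ obj := fun _ => SingleObj.star G
       map := fun {i j} _ => ((x j)⁻¹ * x i : G)
       map_id := fun i => inv_mul_cancel (x i)
       map_comp := fun {i j k} _ _ => by
        change (x k)⁻¹ * x i = ((x k)⁻¹ * x j) * ((x j)⁻¹ * x i)
        group } : ComposableArrows (SingleObj G) n.unop.len)
  naturality _ _ _ := rfl

theorem toNerve_translation {n : SimplexCategoryᵒᵖ} (g : G) (x : (simplicialEG G).obj n) :
    (toNerve G).app n ((translation G g).app n x) = (toNerve G).app n x := by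
  refine CategoryTheory.Functor.ext (fun _ => rfl) fun i j h => ?_
  change (g * x j)⁻¹ * (g * x i) = (1 * ((x j)⁻¹ * x i)) * 1
  group

/-- Tuples with the same image in the nerve differ by the translation which matches their first
entries. -/
theorem exists_smul_eq_of_toNerve_eq {n : SimplexCategoryᵒᵖ} {x y : (simplicialEG G).obj n}
    (h : (toNerve G).app n x = (toNerve G).app n y) :
    ∃ g : G, (translation G g).app n y = x := by
  refine ⟨x 0 * (y 0)⁻¹, funext fun i => ?_⟩
  have key : ∀ j, (x j)⁻¹ * x 0 = (y j)⁻¹ * y 0 := fun j =>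
    congrArg (fun F : ComposableArrows (SingleObj G) n.unop.len =>
      (F.map (homOfLE (Fin.zero_le j)) : G)) h
  change x 0 * (y 0)⁻¹ * y i = x i
  have := key i
  rw [inv_mul_eq_iff_eq_mul] at this
  rw [this]
  group

theorem toNerve_surjective (n : SimplexCategoryᵒᵖ) :
    Function.Surjective ((toNerve G).app n) := by
  intro F
  let F' : ComposableArrows (SingleObj G) n.unop.len := F
  let a : Fin (n.unop.len + 1) → G := fun j => F'.map (homOfLE (Fin.zero_le j))
  refine ⟨fun j => (a j)⁻¹, CategoryTheory.Functor.ext (fun _ => rfl) fun i j h => ?_⟩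
  have : a j = (F'.map h : G) * a i :=
    (congr(F'.map $(Subsingleton.elim _ _))).trans (F'.map_comp (homOfLE (Fin.zero_le i)) h)
  change (a j)⁻¹⁻¹ * (a i)⁻¹ = (1 * (F'.map h : G)) * 1
  rw [this]
  group

/-- The projection `EG → BG`. -/
def projBG (G : Type u) [Group G] : C(EG G, BG G) := (SSet.toTop.map (toNerve G)).hom

theorem projBG_tupleMap {n : SimplexCategoryᵒᵖ} (x : Fin (n.unop.len + 1) → G)
    (t : stdSimplex ℝ (Fin (n.unop.len + 1))) :
    projBG G (tupleMap x t) = simplexMap ((toNerve G).app n x) t :=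
  realization_map_simplexMap (toNerve G) x t

theorem projBG_surjective : Function.Surjective (projBG G) := by
  intro b
  obtain ⟨n, y, t, rfl⟩ := exists_simplexMap_eq (X := nerve (SingleObj G)) b
  obtain ⟨x, rfl⟩ := toNerve_surjective n y
  exact ⟨tupleMap x t, projBG_tupleMap x t⟩

theorem projBG_smul (g : G) (e : EG G) : projBG G (g • e) = projBG G e := by
  obtain ⟨n, x, t, rfl⟩ := exists_tupleMap_eq e
  rw [smul_tupleMap, projBG_tupleMap, projBG_tupleMap]
  exact congr(simplexMap $(toNerve_translation g x) t)

theorem isQuotientMap_projBG : IsQuotientMap (projBG G) := by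
  refine ⟨isCoinducing_iff.2 fun s => ⟨fun h => continuous_Prop.1
    ((continuous_realization_iff (X := nerve (SingleObj G))).2 fun {n} y => ?_),
    fun h => h.preimage (projBG G).2⟩, projBG_surjective⟩
  obtain ⟨x, rfl⟩ := toNerve_surjective n y
  have := (continuous_Prop.2 h).comp (tupleMap x).continuous
  refine this.congr fun t => ?_
  exact congr($(projBG_tupleMap x t) ∈ s)

/-- The map from the realization of the nerve of `G` to the space of orbits of `EG`, which sends
each simplex of the nerve to the orbit of a lift of it. -/
def orbitFamily (G : Type u) [Group G] :
    SimplexFamily (nerve (SingleObj G)) (MulAction.orbitRel.Quotient G (EG G)) where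
  toFun {n} y := ⟨fun t => Quotient.mk _ (tupleMap (toNerve_surjective n y).choose t),
    continuous_quotient_mk'.comp (tupleMap _).continuous⟩
  map {n m} θ y t := by
    have h₁ := (toNerve_surjective n y).choose_spec
    have h₂ := (toNerve_surjective m ((nerve (SingleObj G)).map θ y)).choose_spec
    obtain ⟨g, hg⟩ := exists_smul_eq_of_toNerve_eq (h₂.trans (Eq.trans (congrArg _ h₁.symm)
      ((toNerve G).naturality_apply θ _).symm))
    refine Quotient.sound ⟨g, ?_⟩
    refine Eq.trans ?_ (congr(tupleMap $hg t))
    refine Eq.trans (congrArg (g • ·) (tupleMap_comp θ _ t).symm) (smul_tupleMap g _ t)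

/-- The fibres of `EG → BG` are the orbits of `G`. -/
theorem projBG_eq_iff {e e' : EG G} : projBG G e = projBG G e' ↔ e ∈ MulAction.orbit G e' := by
  refine ⟨fun h => ?_, fun ⟨g, hg⟩ => by rw [← hg]; exact projBG_smul g e'⟩
  have key : ∀ e, (orbitFamily G).desc (projBG G e) = Quotient.mk _ e := fun e => by
    obtain ⟨n, x, t, rfl⟩ := exists_tupleMap_eq e
    rw [projBG_tupleMap]
    refine ((orbitFamily G).desc_simplexMap _ t).trans (Quotient.sound ?_)
    obtain ⟨g, hg⟩ := exists_smul_eq_of_toNerve_eq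
      (toNerve_surjective n ((toNerve G).app n x)).choose_spec
    refine ⟨g, (smul_tupleMap g x t).trans ?_⟩
    exact congr(tupleMap $hg t)
  exact Quotient.exact ((key e).symm.trans (congr((orbitFamily G).desc $h).trans (key e')))

end

/-! ### Step functions -/

/-- Arbitrary functions `(0, 1] → G`, to be compared by the outer measure of the set on which they
differ. The point `0` is left out because, unlike the other points, it lies in a step of length `0`
if the first barycentric coordinate vanishes, so that its value is not compatible with faces. -/
def StepFun (G : Type*) : Type _ := Set.Ioc (0 : ℝ) 1 → G

/-- The set of points of `(0, 1]` at which two functions differ, as a set of real numbers. -/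
def StepFun.diffSet {G : Type*} (f f' : StepFun G) : Set ℝ :=
  Subtype.val '' {y : Set.Ioc (0 : ℝ) 1 | f y ≠ f' y}

theorem StepFun.diffSet_subset_Ioc {G : Type*} (f f' : StepFun G) :
    f.diffSet f' ⊆ Set.Ioc 0 1 := by
  rintro _ ⟨y, -, rfl⟩
  exact y.2

theorem StepFun.volume_diffSet_ne_top {G : Type*} (f f' : StepFun G) :
    volume (f.diffSet f') ≠ ⊤ :=
  measure_ne_top_of_subset (f.diffSet_subset_Ioc f') (by simp)

instance {G : Type*} : PseudoMetricSpace (StepFun G) where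
  dist f f' := volume.real (f.diffSet f')
  dist_self f := by simp [StepFun.diffSet]
  dist_comm f f' := by simp only [StepFun.diffSet, ne_comm]
  dist_triangle f f' f'' := by
    refine (measureReal_mono ?_ (measure_union_ne_top (f.volume_diffSet_ne_top f')
      (f'.volume_diffSet_ne_top f''))).trans (measureReal_union_le _ _)
    rintro _ ⟨y, hy, rfl⟩
    by_cases h : f y = f' y
    · exact .inr ⟨y, fun h' => hy (h.trans h'), rfl⟩
    · exact .inl ⟨y, h, rfl⟩

theorem StepFun.dist_def {G : Type*} (f f' : StepFun G) :
    dist f f' = volume.real (f.diffSet f') := rfl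

/-! ### Step functions from barycentric coordinates -/

/-- The sums `t₀ + … + tⱼ` of the barycentric coordinates. -/
def partialSum {k : ℕ} (t : stdSimplex ℝ (Fin (k + 1))) (j : Fin (k + 1)) : ℝ :=
  ∑ i ∈ Finset.Iic j, t i

theorem partialSum_mono {k : ℕ} (t : stdSimplex ℝ (Fin (k + 1))) : Monotone (partialSum t) :=
  fun _ _ h => Finset.sum_le_sum_of_subset_of_nonneg (Finset.Iic_subset_Iic.2 h)
    fun _ _ _ => stdSimplex.zero_le t _

theorem partialSum_last {k : ℕ} (t : stdSimplex ℝ (Fin (k + 1))) :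
    partialSum t (Fin.last k) = 1 := by
  rw [partialSum, ← stdSimplex.sum_eq_one t]
  congr 1
  ext i
  simp [Fin.le_last]

theorem exists_le_partialSum {k : ℕ} (t : stdSimplex ℝ (Fin (k + 1))) (y : Set.Ioc (0 : ℝ) 1) :
    (Finset.univ.filter fun j => (y : ℝ) ≤ partialSum t j).Nonempty :=
  ⟨Fin.last k, by simpa [partialSum_last] using y.2.2⟩

/-- The index of the step at `y` when `(0, 1]` is divided into consecutive intervals of lengths
`t₀, …, tₖ`. -/
def stepIndex {k : ℕ} (t : stdSimplex ℝ (Fin (k + 1))) (y : Set.Ioc (0 : ℝ) 1) : Fin (k + 1) :=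
  Finset.min' _ (exists_le_partialSum t y)

theorem stepIndex_le_iff {k : ℕ} {t : stdSimplex ℝ (Fin (k + 1))} {y : Set.Ioc (0 : ℝ) 1}
    {j : Fin (k + 1)} : stepIndex t y ≤ j ↔ (y : ℝ) ≤ partialSum t j := by
  refine ⟨fun h => ?_, fun h => Finset.min'_le _ _ (by simpa using h)⟩
  have := Finset.min'_mem _ (exists_le_partialSum t y)
  exact (Finset.mem_filter.1 this).2.trans (partialSum_mono t h)

/-- Dividing `(0, 1]` into intervals is compatible with the simplicial operators. -/
theorem stepIndex_map {k l : ℕ} (θ : Fin (l + 1) →o Fin (k + 1)) (t : stdSimplex ℝ (Fin (l + 1)))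
    (y : Set.Ioc (0 : ℝ) 1) : stepIndex (stdSimplex.map θ t) y = θ (stepIndex t y) := by
  have hsum : ∀ j, partialSum (stdSimplex.map θ t) j = ∑ i with θ i ≤ j, t i := fun j => by
    simp only [partialSum, stdSimplex.map_coe, FunOnFinite.linearMap_apply_apply]
    rw [← Finset.sum_fiberwise_of_maps_to (s := Finset.univ.filter fun i => θ i ≤ j)
      (t := Finset.Iic j) (g := θ) (by simp)]
    refine Finset.sum_congr rfl fun j' hj' => Finset.sum_congr ?_ fun _ _ => rfl
    ext i
    simp only [Finset.mem_filter, Finset.mem_univ, true_and]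
    exact ⟨fun h => ⟨h ▸ Finset.mem_Iic.1 hj', h⟩, fun h => h.2⟩
  refine eq_of_forall_ge_iff fun j => ?_
  rw [stepIndex_le_iff, hsum]
  constructor
  · intro h
    have hne : (Finset.univ.filter fun i => θ i ≤ j).Nonempty := by
      by_contra hne
      rw [Finset.not_nonempty_iff_eq_empty.1 hne, Finset.sum_empty] at h
      exact absurd y.2.1 (not_lt.2 h)
    have hmax := (Finset.mem_filter.1 (Finset.max'_mem _ hne)).2
    refine (θ.monotone (stepIndex_le_iff.2 (h.trans ?_))).trans hmax
    exact Finset.sum_le_sum_of_subset_of_nonneg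
      (fun i hi => Finset.mem_Iic.2 (Finset.le_max' _ _ hi)) fun _ _ _ => stdSimplex.zero_le t _
  · intro h
    refine (stepIndex_le_iff.1 (le_refl (stepIndex t y))).trans ?_
    refine Finset.sum_le_sum_of_subset_of_nonneg (fun i hi => ?_) fun _ _ _ =>
      stdSimplex.zero_le t _
    exact Finset.mem_filter.2 ⟨Finset.mem_univ _, (θ.monotone (Finset.mem_Iic.1 hi)).trans h⟩

/-- The step function with the values `x₀, …, xₖ` on consecutive intervals of lengths
`t₀, …, tₖ`. -/
def stepFun {G : Type*} {k : ℕ} (x : Fin (k + 1) → G) (t : stdSimplex ℝ (Fin (k + 1))) :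
    StepFun G :=
  fun y => x (stepIndex t y)

theorem dist_stepFun_le {G : Type*} {k : ℕ} (x : Fin (k + 1) → G)
    (s t : stdSimplex ℝ (Fin (k + 1))) :
    dist (stepFun x s) (stepFun x t) ≤ ∑ j, |partialSum t j - partialSum s j| := by
  have hsub : (stepFun x s).diffSet (stepFun x t) ⊆
      ⋃ j, Set.uIcc (partialSum s j) (partialSum t j) := by
    rintro _ ⟨y, hy, rfl⟩
    have hne : stepIndex s y ≠ stepIndex t y := fun h => hy (congrArg x h)
    obtain ⟨j, hj⟩ : ∃ j, ¬ (stepIndex s y ≤ j ↔ stepIndex t y ≤ j) := by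
      by_contra! h
      exact hne (eq_of_forall_ge_iff h)
    simp only [stepIndex_le_iff] at hj
    refine Set.mem_iUnion.2 ⟨j, Set.mem_uIcc.2 ?_⟩
    by_cases h : (y : ℝ) ≤ partialSum s j
    · exact .inr ⟨(not_le.1 fun h' => hj (iff_of_true h h')).le, h⟩
    · exact .inl ⟨(not_le.1 h).le, not_lt.1 fun h' => hj (iff_of_false h (not_le.2 h'))⟩
  refine (measureReal_mono hsub ?_).trans ((measureReal_iUnion_fintype_le _).trans ?_)
  · exact ((measure_iUnion_fintype_le _ _).trans_lt (ENNReal.sum_lt_top.2 fun j _ => by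
      simp [Real.volume_interval])).ne
  · simp [measureReal_def, Real.volume_interval]

theorem continuous_stepFun {G : Type*} {k : ℕ} (x : Fin (k + 1) → G) :
    Continuous (stepFun x) := by
  refine continuous_iff_continuousAt.2 fun t => tendsto_iff_dist_tendsto_zero.2 ?_
  refine squeeze_zero (fun _ => dist_nonneg) (fun s => dist_stepFun_le x s t) ?_
  have hc : Continuous fun s : stdSimplex ℝ (Fin (k + 1)) =>
      ∑ j, |partialSum t j - partialSum s j| := by
    unfold partialSum
    refine continuous_finsetSum _ fun j _ => (continuous_const.sub
      (continuous_finsetSum _ fun i _ => ?_)).abs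
    exact (continuous_apply i).comp continuous_subtype_val
  simpa using hc.tendsto t

/-! ### Translates in `EG` are far apart -/

section

variable {G : Type u} [Group G]
/-- The map from `EG` to the space of step functions which sends the point with barycentric
coordinates `(t₀, …, tₖ)` in the simplex `(g₀, …, gₖ)` to the function which is `gᵢ` on the `i`-th
of consecutive intervals of lengths `t₀, …, tₖ`. -/
def stepMap (G : Type u) [Group G] : C(EG G, StepFun G) :=
  SimplexFamily.desc (X := simplicialEG G)
    { toFun := fun {n} (x : Fin (n.unop.len + 1) → G) => ⟨stepFun x, continuous_stepFun x⟩
      map := fun θ x t => funext fun y =>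
        congrArg x (stepIndex_map θ.unop.toOrderHom t y).symm }

theorem stepMap_tupleMap {n : SimplexCategoryᵒᵖ} (x : Fin (n.unop.len + 1) → G)
    (t : stdSimplex ℝ (Fin (n.unop.len + 1))) : stepMap G (tupleMap x t) = stepFun x t :=
  SimplexFamily.desc_simplexMap (X := simplicialEG G) _ x t

theorem stepMap_smul (g : G) (e : EG G) (y : Set.Ioc (0 : ℝ) 1) :
    stepMap G (g • e) y = g * stepMap G e y := by
  obtain ⟨n, x, t, rfl⟩ := exists_tupleMap_eq e
  rw [smul_tupleMap, stepMap_tupleMap, stepMap_tupleMap]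
  rfl

/-- The pseudometric on `EG` induced by the map to the space of step functions. -/
def stepDist (e e' : EG G) : ℝ := dist (stepMap G e) (stepMap G e')

theorem stepDist_self (e : EG G) : stepDist e e = 0 := dist_self _

theorem stepDist_comm (e e' : EG G) : stepDist e e' = stepDist e' e := dist_comm _ _

theorem stepDist_triangle (e₁ e₂ e₃ : EG G) :
    stepDist e₁ e₃ ≤ stepDist e₁ e₂ + stepDist e₂ e₃ := dist_triangle _ _ _

@[fun_prop]
theorem continuous_stepDist (e : EG G) : Continuous (stepDist e) :=
  continuous_const.dist (stepMap G).continuous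

theorem stepDist_smul_smul (g : G) (e e' : EG G) : stepDist (g • e) (g • e') = stepDist e e' := by
  simp only [stepDist, StepFun.dist_def, StepFun.diffSet, stepMap_smul, ne_eq, mul_right_inj]

theorem stepDist_smul_self {g : G} (hg : g ≠ 1) (e : EG G) : stepDist (g • e) e = 1 := by
  have h : (stepMap G (g • e)).diffSet (stepMap G e) = Set.Ioc 0 1 := by
    simp only [StepFun.diffSet, stepMap_smul, ne_eq, mul_eq_right, hg, not_false_eq_true]
    exact Set.image_univ.trans Subtype.range_coe
  simp [stepDist, StepFun.dist_def, h]

/-- The projection `EG → BG` is the quotient by the free and properly discontinuous action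
of `G`. -/
theorem isQuotientCoveringMap_projBG : IsQuotientCoveringMap (projBG G) G where
  toIsQuotientMap := isQuotientMap_projBG
  continuous_const_smul := continuous_const_smul
  apply_eq_iff_mem_orbit := projBG_eq_iff
  disjoint e := by
    refine ⟨{e' | stepDist e e' < 1 / 2},
      (isOpen_lt (by fun_prop) continuous_const).mem_nhds (by simp [stepDist_self]), ?_⟩
    rintro g ⟨_, ⟨e', he', rfl⟩, hge'⟩
    by_contra hg
    have h₁ := stepDist_triangle (g • e') e e'
    rw [stepDist_smul_self hg, stepDist_comm _ e] at h₁
    simp only [Set.mem_ofPred_eq] at he' hge'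
    linarith

end

/-! ### Coordinates on spaces of measures -/

/-- The expected value of a function with respect to a finitely supported probability measure. -/
def FinProb.expect {X : Type*} (μ : FinProb X) (f : X → ℝ) : ℝ :=
  (StdSimplex.weights μ).sum fun x r => r * f x

theorem FinProb.expect_congr {X : Type*} {μ : FinProb X} {f f' : X → ℝ}
    (h : ∀ x ∈ μ.support, f x = f' x) : μ.expect f = μ.expect f' :=
  Finset.sum_congr rfl fun x hx => by simp only [h x hx]

theorem expect_convexSum {ι : Type*} [Fintype ι] {X : Type*} (x : ι → X) (t : stdSimplex ℝ ι)
    (f : X → ℝ) : FinProb.expect (convexSum x t) f = ∑ i, t i * f (x i) := by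
  simp only [FinProb.expect, convexSum, StdSimplex.weights_map]
  rw [Finsupp.sum_mapDomain_index (by simp) (by intros; ring),
    Finsupp.sum_fintype _ _ (by simp)]
  rfl

open Classical in
theorem FinProb.weights_map_apply {X Y : Type*} (μ : FinProb X) (h : X → Y) (y : Y) :
    (StdSimplex.map h μ).weights y = μ.expect fun x => if h x = y then 1 else 0 := by
  change Finsupp.mapDomain h (StdSimplex.weights μ) y = _
  simp [FinProb.expect, Finsupp.mapDomain, Finsupp.sum_apply, Finsupp.single_apply]

open Classical in
theorem weights_convexSum_apply {V : Type*} (s : Finset V) (t : stdSimplex ℝ s) (v : V) :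
    (convexSum ((↑) : s → V) t).weights v = if h : v ∈ s then t ⟨v, h⟩ else 0 := by
  simp only [convexSum, StdSimplex.weights_map]
  split_ifs with h
  · exact Finsupp.mapDomain_apply Subtype.val_injective _ (⟨v, h⟩ : s)
  · exact Finsupp.mapDomain_of_notMem_range _ _ (by simpa using h)

theorem exists_faceInclusion_eq {V : Type v} {n : ℕ} (w : SimplexSkeleton V n) :
    ∃ t, faceInclusion ⟨w.1.weights.support, w.2⟩ t = w := by
  refine ⟨⟨fun v => w.1.weights v, fun v => w.1.weights_nonneg v, ?_⟩, ?_⟩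
  · rw [Finset.sum_coe_sort w.1.weights.support fun v => w.1.weights v]
    exact w.1.total
  · refine Subtype.ext (StdSimplex.ext (Finsupp.ext fun v => ?_))
    refine (weights_convexSum_apply _ _ v).trans ?_
    split_ifs with h
    · rfl
    · exact (Finsupp.notMem_support_iff.1 h).symm

/-- The coordinate vectors of the points of a closed subset of the skeleton which lie in a given
finite subcomplex form a closed set in the product topology. -/
theorem isClosed_weights {V : Type v} {n : ℕ} {C : Set (SimplexSkeleton V n)} (hC : IsClosed C)
    (S : Finset V) :
    IsClosed {f : V → ℝ | ∃ w ∈ C, w.1.weights.support ⊆ S ∧ ⇑w.1.weights = f} := by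
  classical
  have heq : {f : V → ℝ | ∃ w ∈ C, w.1.weights.support ⊆ S ∧ ⇑w.1.weights = f} =
      ⋃ s ∈ {s : {s : Finset V // s.card ≤ n + 1} | s.1 ⊆ S},
        (fun t => ⇑(faceInclusion s t).1.weights) '' (faceInclusion s ⁻¹' C) := by
    ext f
    simp only [Set.mem_ofPred_eq, Set.mem_iUnion, Set.mem_image, Set.mem_preimage, exists_prop]
    constructor
    · rintro ⟨w, hw, hS, rfl⟩
      obtain ⟨t, ht⟩ := exists_faceInclusion_eq w
      exact ⟨⟨_, w.2⟩, hS, t, by rwa [ht], by rw [ht]⟩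
    · rintro ⟨s, hs, t, ht, rfl⟩
      refine ⟨_, ht, fun v hv => hs ?_, rfl⟩
      by_contra h
      exact Finsupp.mem_support_iff.1 hv ((weights_convexSum_apply s.1 t v).trans (dif_neg h))
  rw [heq]
  have hfin : {s : {s : Finset V // s.card ≤ n + 1} | s.1 ⊆ S}.Finite :=
    Set.Finite.of_finite_image (f := Subtype.val) ((Finset.finite_toSet S.powerset).subset
      (by rintro _ ⟨s, hs, rfl⟩; simpa using hs)) Subtype.val_injective.injOn
  refine hfin.isClosed_biUnion fun s _ => ?_
  have hcl : IsClosed (faceInclusion s ⁻¹' C) := isClosed_coinduced.1 (isClosed_iSup_iff.1 hC s)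
  refine (hcl.isCompact.image (continuous_pi fun v => ?_)).isClosed
  change Continuous fun t => (convexSum ((↑) : s.1 → V) t).weights v
  simp only [weights_convexSum_apply]
  by_cases h : v ∈ s.1
  · simp only [h, dite_true]
    exact (continuous_apply (⟨v, h⟩ : s.1)).comp continuous_subtype_val
  · simp only [h, dite_false]
    exact continuous_const

/-- For a locally finite family of functions `u v`, the measures for which the expected values of
the `u v` are the coordinates of a point in a given closed subset of the skeleton form a closed
set. -/
theorem isClosed_expect {X : Type*} [TopologicalSpace X] {V : Type v} {n : ℕ} {u : V → X → ℝ}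
    (hu : ∀ v, Continuous (u v)) (hfin : LocallyFinite fun v => Function.support (u v))
    {C : Set (SimplexSkeleton V n)} (hC : IsClosed C) :
    IsClosed {μ : FinProb X | ∃ w ∈ C, ∀ v, w.1.weights v = μ.expect (u v)} := by
  classical
  refine isClosed_iSup_iff.2 fun m => isClosed_coinduced.2 ?_
  suffices h : IsClosed {p : (Fin m → X) × stdSimplex ℝ (Fin m) |
      ∃ w ∈ C, ∀ v, w.1.weights v = ∑ i, p.2 i * u v (p.1 i)} by
    convert h.preimage CompactCoherentification.continuous_mk_symm using 1
    ext p
    refine exists_congr fun w => and_congr_right' (forall_congr' fun v => ?_)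
    exact Eq.congr_right (expect_convexSum _ _ (u v))
  refine isOpen_compl_iff.1 (isOpen_iff_mem_nhds.2 fun p hp => ?_)
  choose N hN hNfin using fun i => hfin (p.1 i)
  let S : Finset V := Finset.univ.biUnion fun i => (hNfin i).toFinset
  have hΦ : Continuous fun (q : (Fin m → X) × stdSimplex ℝ (Fin m)) (v : V) =>
      ∑ i, q.2 i * u v (q.1 i) :=
    continuous_pi fun v => continuous_finsetSum _ fun i _ =>
      ((continuous_apply i).comp (continuous_subtype_val.comp continuous_snd)).mul
        ((hu v).comp ((continuous_apply i).comp continuous_fst))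
  have hmem : {q : (Fin m → X) × stdSimplex ℝ (Fin m) | ∀ i, q.1 i ∈ N i} ∈ 𝓝 p :=
    Filter.eventually_all.2 fun i =>
      ((continuous_apply i).comp continuous_fst).continuousAt.eventually_mem (hN i)
  have hE := ((isClosed_weights hC S).preimage hΦ).isOpen_compl.mem_nhds
    (x := p) (by rintro ⟨w, hw, -, h⟩; exact hp ⟨w, hw, fun v => congrFun h v⟩)
  filter_upwards [hmem, hE] with q hq hqE
  rintro ⟨w, hw, h⟩
  refine hqE ⟨w, hw, fun v hv => ?_, funext h⟩
  have hne := Finsupp.mem_support_iff.1 hv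
  rw [h] at hne
  obtain ⟨i, -, hi⟩ := Finset.exists_ne_zero_of_sum_ne_zero hne
  exact Finset.mem_biUnion.2 ⟨i, Finset.mem_univ i, (hNfin i).mem_toFinset.2
    ⟨q.1 i, right_ne_zero_of_mul hi, hq i⟩⟩

/-! ### From sections to homotopy fixed points -/

section

variable {G : Type u} [Group G]

/-- The endpoint of the lift of a path in `BG` to `EG`, with a fixed initial point, depends
continuously on the path. -/
theorem exists_lift_endpoint (x₀ : BG G) :
    ∃ L : C(BasedPaths (BG G) x₀, EG G), ∀ γ, projBG G (L γ) = endpoint γ := by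
  obtain ⟨e₀, he₀⟩ := projBG_surjective x₀
  have hc : Continuous fun q : unitInterval × BasedPaths (BG G) x₀ =>
      ((CompactCoherentification.mk _).symm q.2).1 q.1 := by
    have := (continuous_subtype_val.comp (CompactCoherentification.continuous_mk_symm
      (X := {γ : C(unitInterval, BG G) // γ 0 = x₀}))).comp
        (continuous_snd (X := unitInterval) (Y := BasedPaths (BG G) x₀))
    exact ContinuousEval.continuous_eval.comp (this.prodMk continuous_fst)
  let H : C(unitInterval × BasedPaths (BG G) x₀, BG G) := ⟨_, hc⟩
  have cov : IsCoveringMap (projBG G) := isQuotientCoveringMap_projBG.isCoveringMap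
  have h₀ : ∀ γ, H (0, γ) = projBG G ((ContinuousMap.const _ e₀) γ) := fun γ =>
    ((CompactCoherentification.mk _).symm γ).2.trans he₀.symm
  refine ⟨(cov.liftHomotopy H _ h₀).comp (.prodMk (.const _ 1) (.id _)), fun γ => ?_⟩
  exact congrFun (cov.liftHomotopy_lifts H _ h₀) (1, γ)

open Classical in
/-- An element of `G` which translates `e'` to `e`, if there is one. -/
def translator (e e' : EG G) : G := if h : ∃ g : G, g • e' = e then h.choose else 1

theorem translator_smul {e e' : EG G} (h : projBG G e' = projBG G e) :
    translator e e' • e' = e := by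
  have h' : ∃ g : G, g • e' = e := projBG_eq_iff.1 h.symm
  rw [translator, dif_pos h']
  exact h'.choose_spec

theorem smul_right_cancel_EG {g g' : G} {e : EG G} (h : g • e = g' • e) : g = g' :=
  isQuotientCoveringMap_projBG.isCancelSMul.right_cancel' _ _ _ h

theorem translator_eq_iff {e e' : EG G} (h : projBG G e' = projBG G e) {g : G} :
    translator e e' = g ↔ g • e' = e :=
  ⟨fun hg => hg ▸ translator_smul h, fun hg =>
    smul_right_cancel_EG ((translator_smul h).trans hg.symm)⟩

/-- A bump function: it is `1` at the points of distance at most `1 / 8`, and `0` at the points of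
distance at least `1 / 4`. -/
def bump (d : ℝ) : ℝ := max 0 (min 1 (2 - 8 * d))

@[fun_prop]
theorem continuous_bump : Continuous bump := by unfold bump; fun_prop

theorem bump_eq_one {d : ℝ} (h : d ≤ 1 / 8) : bump d = 1 := by
  rw [bump, min_eq_left (by linarith), max_eq_right zero_le_one]

theorem bump_eq_zero {d : ℝ} (h : 1 / 4 ≤ d) : bump d = 0 := by
  rw [bump, max_eq_left]
  exact (min_le_right _ _).trans (by linarith)

theorem one_le_stepDist_add {g g' : G} (h : g ≠ g') (e e' : EG G) :
    1 ≤ stepDist e' (g • e) + stepDist e' (g' • e) := by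
  have h₁ : stepDist (g • e) (g' • e) = 1 := by
    have := stepDist_smul_smul g' ((g'⁻¹ * g) • e) e
    rw [smul_smul, mul_inv_cancel_left] at this
    rw [this, stepDist_smul_self]
    rwa [ne_eq, inv_mul_eq_one, eq_comm]
  have h₂ := stepDist_triangle (g • e) e' (g' • e)
  rw [stepDist_comm _ e'] at h₂
  linarith

/-- The translates of a small ball around `e₀` form a locally finite family. -/
theorem locallyFinite_bump {X : Type*} [TopologicalSpace X] (L : C(X, EG G)) (e₀ : EG G) :
    LocallyFinite fun g : G => Function.support fun x => bump (stepDist e₀ (g • L x)) := by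
  intro x₁
  have ho : IsOpen {x | stepDist (L x₁) (L x) < 1 / 4} :=
    isOpen_lt ((continuous_stepDist _).comp L.continuous) continuous_const
  refine ⟨_, ho.mem_nhds (by simp [stepDist_self]), Set.Subsingleton.finite ?_⟩
  have key : ∀ {g : G} {x}, bump (stepDist e₀ (g • L x)) ≠ 0 → stepDist (L x₁) (L x) < 1 / 4 →
      stepDist e₀ (g • L x₁) < 1 / 2 := fun {g x} h h' => by
    have h₁ := stepDist_triangle e₀ (g • L x) (g • L x₁)
    rw [stepDist_smul_smul, stepDist_comm (L x)] at h₁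
    have h₂ : stepDist e₀ (g • L x) < 1 / 4 := by
      by_contra h₃
      exact h (bump_eq_zero (not_lt.1 h₃))
    linarith
  rintro g ⟨x, hx, hx'⟩ g' ⟨y, hy, hy'⟩
  by_contra hg
  have := one_le_stepDist_add hg (L x₁) e₀
  linarith [key hx hx', key hy hy']

section

variable {x₀ : BG G} {n : ℕ} (L : C(BasedPaths (BG G) x₀, EG G))
  (s : C(BG G, FibFinProb (endpoint : BasedPaths (BG G) x₀ → BG G) (n + 1)))

/-- The weighted set of paths chosen by the section at the image of `e`, in which each path is
replaced by the element of `G` which translates the endpoint of its lift to `e`. -/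
def sectionToSkeleton (e : EG G) : SimplexSkeleton G n :=
  ⟨StdSimplex.map (fun γ => translator e (L γ)) (s (projBG G e)).1, by
    classical
    exact (Finset.card_le_card Finsupp.mapDomain_support).trans
      (Finset.card_image_le.trans (s (projBG G e)).2.1)⟩

variable {L s} (hL : ∀ γ, projBG G (L γ) = endpoint γ) (hs : ∀ y, (s y).proj = y)
include hL hs

theorem projBG_lift_of_mem_support {e : EG G} {γ : BasedPaths (BG G) x₀}
    (hγ : γ ∈ (s (projBG G e)).1.support) : projBG G (L γ) = projBG G e := by
  rw [hL, ← FibFinProb.proj_eq _ hγ, hs]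

open Classical in
theorem weights_sectionToSkeleton (e : EG G) (g : G) :
    (sectionToSkeleton L s e).1.weights g =
      (s (projBG G e)).1.expect fun γ => if g • L γ = e then 1 else 0 := by
  refine (FinProb.weights_map_apply _ _ g).trans (FinProb.expect_congr fun γ hγ => ?_)
  exact if_congr (translator_eq_iff (projBG_lift_of_mem_support hL hs hγ)) rfl rfl

theorem sectionToSkeleton_smul (g : G) (e : EG G) :
    sectionToSkeleton L s (g • e) = g • sectionToSkeleton L s e := by
  classical
  refine Subtype.ext (StdSimplex.ext (Finsupp.ext fun h => ?_))
  have h₁ : (g • sectionToSkeleton L s e).1.weights h =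
      (sectionToSkeleton L s e).1.weights (g⁻¹ * h) := by
    have := Finsupp.mapDomain_apply (mul_right_injective g)
      (sectionToSkeleton L s e).1.weights (g⁻¹ * h)
    simp only [mul_inv_cancel_left] at this
    exact this
  rw [h₁, weights_sectionToSkeleton hL hs, weights_sectionToSkeleton hL hs, projBG_smul]
  refine FinProb.expect_congr fun γ _ => if_congr ?_ rfl rfl
  rw [mul_smul, inv_smul_eq_iff]

/-- Near `e₀`, the coordinates of the skeleton-valued map are the expected values of continuous
functions. -/
theorem weights_sectionToSkeleton_eq_expect_bump {e₀ e : EG G} (he : stepDist e₀ e < 1 / 8)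
    (g : G) :
    (sectionToSkeleton L s e).1.weights g =
      (s (projBG G e)).1.expect fun γ => bump (stepDist e₀ (g • L γ)) := by
  rw [weights_sectionToSkeleton hL hs]
  refine FinProb.expect_congr fun γ hγ => ?_
  have h := translator_smul (projBG_lift_of_mem_support hL hs hγ)
  set g' := translator e (L γ)
  split_ifs with hg
  · rw [hg, bump_eq_one he.le]
  · have hne : g ≠ g' := fun h' => hg (h' ▸ h)
    have := one_le_stepDist_add hne (L γ) e₀
    rw [h] at this
    rw [bump_eq_zero (by linarith)]

theorem continuous_sectionToSkeleton : Continuous (sectionToSkeleton L s) := by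
  refine continuous_iff_isClosed.2 fun C hC => ?_
  refine isOpen_compl_iff.1 (isOpen_iff_mem_nhds.2 fun e₀ he₀ => ?_)
  have hD := isClosed_expect (fun g : G => (continuous_bump.comp (continuous_stepDist e₀)).comp
    ((continuous_const_smul g).comp L.continuous)) (locallyFinite_bump L e₀) hC
  have hO : IsOpen {e | stepDist e₀ e < 1 / 8} := isOpen_lt (by fun_prop) continuous_const
  have hcont : Continuous fun e => (s (projBG G e)).1 :=
    continuous_subtype_val.comp (s.continuous.comp (projBG G).continuous)
  have hiff : ∀ e, stepDist e₀ e < 1 / 8 →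
      (sectionToSkeleton L s e ∈ C ↔ ∃ w ∈ C, ∀ g, w.1.weights g =
        (s (projBG G e)).1.expect fun γ => bump (stepDist e₀ (g • L γ))) := fun e he => by
    simp only [← weights_sectionToSkeleton_eq_expect_bump hL hs he]
    refine ⟨fun h => ⟨_, h, fun _ => rfl⟩, fun ⟨w, hw, h⟩ => ?_⟩
    rwa [← show w = sectionToSkeleton L s e from
      Subtype.ext (StdSimplex.ext (Finsupp.ext h))]
  have h₀ : stepDist e₀ e₀ < 1 / 8 := by simp [stepDist_self]
  filter_upwards [hO.mem_nhds h₀, (hD.preimage hcont).isOpen_compl.mem_nhds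
    fun h => he₀ ((hiff e₀ h₀).2 h)] with e he he'
  exact fun h => he' ((hiff e he).1 h)

end

theorem nonempty_homotopyFixedPoints_of_section {x₀ : BG G} {n : ℕ}
    {s : C(BG G, FibFinProb (endpoint : BasedPaths (BG G) x₀ → BG G) (n + 1))}
    (hs : ∀ y, (s y).proj = y) : Nonempty (HomotopyFixedPoints G (SimplexSkeleton G n)) := by
  obtain ⟨L, hL⟩ := exists_lift_endpoint x₀
  exact ⟨CompactCoherentification.mk _ ⟨⟨_, continuous_sectionToSkeleton hL hs⟩,
    sectionToSkeleton_smul hL hs⟩⟩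

end

/-! ### The contraction of `EG` -/

section

variable {G : Type u} [Group G]

/-- The point of the cone on `Δᵏ` which divides the segment from the apex, the vertex `0`, to the
point `t` of the base in the ratio `r`. -/
def coneCoord {k : ℕ} (t : stdSimplex ℝ (Fin (k + 1))) (r : unitInterval) :
    stdSimplex ℝ (Fin (k + 1 + 1)) :=
  ⟨Fin.cons (1 - r) fun i => r * t i, fun i => by
    cases i using Fin.cases with
    | zero => simpa using r.2.2
    | succ i => simpa using mul_nonneg r.2.1 (stdSimplex.zero_le t i), by
    simp [Fin.sum_univ_succ (n := k + 1), ← Finset.mul_sum]⟩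

@[simp]
theorem coneCoord_zero {k : ℕ} (t : stdSimplex ℝ (Fin (k + 1))) (r : unitInterval) :
    coneCoord t r 0 = 1 - r := rfl

@[simp]
theorem coneCoord_succ {k : ℕ} (t : stdSimplex ℝ (Fin (k + 1))) (r : unitInterval)
    (i : Fin (k + 1)) : coneCoord t r i.succ = r * t i := rfl

theorem continuous_coneCoord {k : ℕ} : Continuous
    fun q : stdSimplex ℝ (Fin (k + 1)) × unitInterval => coneCoord q.1 q.2 := by
  refine Continuous.subtype_mk (continuous_pi fun i => ?_) _
  cases i using Fin.cases with
  | zero => exact continuous_const.sub (continuous_subtype_val.comp continuous_snd)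
  | succ i =>
    exact (continuous_subtype_val.comp continuous_snd).mul
      ((continuous_apply i).comp (continuous_subtype_val.comp continuous_fst))

/-- The simplicial operator `⦋m + 1⦌ ⟶ ⦋n + 1⦌` which fixes `0` and is `θ` on the other
vertices. -/
def coneHom {n m : SimplexCategory} (θ : m ⟶ n) :
    SimplexCategory.mk (m.len + 1) ⟶ SimplexCategory.mk (n.len + 1) :=
  SimplexCategory.Hom.mk
    { toFun := Fin.cons 0 fun i => (θ i).succ
      monotone' := by
        intro i j h
        cases i using Fin.cases with
        | zero => exact Fin.zero_le _
        | succ i =>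
          cases j using Fin.cases with
          | zero => exact absurd h (by simp)
          | succ j =>
            exact Fin.succ_le_succ_iff.2 (θ.toOrderHom.monotone (Fin.succ_le_succ_iff.1 h)) }

theorem coneHom_zero {n m : SimplexCategory} (θ : m ⟶ n) : coneHom θ 0 = 0 := rfl

theorem coneHom_succ {n m : SimplexCategory} (θ : m ⟶ n) (i : Fin (m.len + 1)) :
    coneHom θ i.succ = (θ i).succ := rfl

theorem coneCoord_map {n m : SimplexCategory} (θ : m ⟶ n) (t : stdSimplex ℝ (Fin (m.len + 1)))
    (r : unitInterval) :
    coneCoord (stdSimplex.map θ t) r = stdSimplex.map (coneHom θ) (coneCoord t r) := by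
  ext i
  rw [stdSimplex.map_coe, FunOnFinite.linearMap_apply_apply, Finset.sum_filter]
  refine Eq.trans ?_ (Fin.sum_univ_succ (n := m.len + 1) _).symm
  simp only [coneHom_zero, coneHom_succ]
  cases i using Fin.cases with
  | zero => simp [Fin.succ_ne_zero]
  | succ i =>
    simp [(Fin.succ_ne_zero i).symm, FunOnFinite.linearMap_apply_apply, Finset.sum_filter,
      Finset.mul_sum]

/-- The map from a simplex of `EG` to the space of paths in `EG`, which sends a point to the
segment that joins the vertex `1` to it in the cone over the simplex. -/
def coneSegment {n : SimplexCategoryᵒᵖ} (x : Fin (n.unop.len + 1) → G) :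
    C(stdSimplex ℝ (Fin (n.unop.len + 1)), C(unitInterval, EG G)) :=
  ContinuousMap.curry
    ⟨fun q => tupleMap (n := .op (.mk (n.unop.len + 1))) (Fin.cons 1 x) (coneCoord q.1 q.2),
      (tupleMap _).continuous.comp continuous_coneCoord⟩

theorem coneSegment_apply {n : SimplexCategoryᵒᵖ} (x : Fin (n.unop.len + 1) → G)
    (t : stdSimplex ℝ (Fin (n.unop.len + 1))) (r : unitInterval) :
    coneSegment x t r =
      tupleMap (n := .op (.mk (n.unop.len + 1))) (Fin.cons 1 x) (coneCoord t r) :=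
  rfl

theorem coneSegment_comp {n m : SimplexCategoryᵒᵖ} (θ : n ⟶ m) (x : Fin (n.unop.len + 1) → G)
    (t : stdSimplex ℝ (Fin (m.unop.len + 1))) :
    coneSegment (fun i => x (θ.unop i)) t = coneSegment x (stdSimplex.map θ.unop t) := by
  ext r
  rw [coneSegment_apply, coneSegment_apply, coneCoord_map]
  refine Eq.trans ?_ (tupleMap_comp (n := .op (.mk (n.unop.len + 1)))
    (m := .op (.mk (m.unop.len + 1))) (coneHom θ.unop).op (Fin.cons 1 x) (coneCoord t r))
  congr 2
  ext i
  cases i using Fin.cases <;> rfl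

/-- The contraction of `EG` to the vertex `1`: the paths from this vertex to all points. -/
def contraction (G : Type u) [Group G] : C(EG G, C(unitInterval, EG G)) :=
  SimplexFamily.desc (X := simplicialEG G)
    { toFun := fun x => coneSegment x
      map := fun θ x t => coneSegment_comp θ x t }

theorem contraction_tupleMap {n : SimplexCategoryᵒᵖ} (x : Fin (n.unop.len + 1) → G)
    (t : stdSimplex ℝ (Fin (n.unop.len + 1))) : contraction G (tupleMap x t) = coneSegment x t :=
  SimplexFamily.desc_simplexMap (X := simplicialEG G) _ x t

/-- The vertex `1` of `EG`. -/
def baseVertex (G : Type u) [Group G] : EG G :=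
  tupleMap (n := .op (.mk 0)) (fun _ => (1 : G)) default

theorem contraction_zero (e : EG G) : contraction G e 0 = baseVertex G := by
  obtain ⟨n, x, t, rfl⟩ := exists_tupleMap_eq e
  rw [contraction_tupleMap, coneSegment_apply]
  refine Eq.trans (congrArg _ ?_) (tupleMap_comp (n := .op (.mk (n.unop.len + 1)))
    (m := .op (.mk 0)) (SimplexCategory.const _ _ 0).op (Fin.cons 1 x) default).symm
  ext i
  rw [stdSimplex.map_coe, FunOnFinite.linearMap_apply_apply, Finset.sum_filter]
  have h : ∀ j, SimplexCategory.const (.mk 0) (.mk (n.unop.len + 1)) 0 j = 0 := fun _ => rfl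
  cases i using Fin.cases with
  | zero => simp [h]
  | succ i => simp [h, (Fin.succ_ne_zero i).symm]

theorem contraction_one (e : EG G) : contraction G e 1 = e := by
  obtain ⟨n, x, t, rfl⟩ := exists_tupleMap_eq e
  rw [contraction_tupleMap, coneSegment_apply]
  refine Eq.trans (congrArg _ ?_) (tupleMap_comp (n := .op (.mk (n.unop.len + 1)))
    (m := n) (SimplexCategory.δ (0 : Fin (n.unop.len + 2))).op (Fin.cons 1 x) t).symm
  ext i
  rw [stdSimplex.map_coe, FunOnFinite.linearMap_apply_apply, Finset.sum_filter]
  have h : ∀ j, SimplexCategory.δ (0 : Fin (n.unop.len + 2)) j = j.succ := fun _ => rfl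
  cases i using Fin.cases with
  | zero => simp [h]
  | succ i => simp [h]

/-- The path from the vertex `1` to `e` which the contraction gives. -/
def contractionPath (e : EG G) : Path (baseVertex G) e where
  toContinuousMap := contraction G e
  source' := contraction_zero e
  target' := contraction_one e

theorem continuous_contractionPath :
    Continuous fun q : EG G × unitInterval => contractionPath q.1 q.2 :=
  ContinuousMap.continuous_uncurry_of_continuous (contraction G)

/-- The image in `BG` of each point of `EG` can be joined to the base point by a path which depends
continuously on the point of `EG`. -/
theorem exists_continuous_basedPaths (x₀ : BG G) :
    ∃ Γ : C(EG G, BasedPaths (BG G) x₀), ∀ e, endpoint (Γ e) = projBG G e := by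
  obtain ⟨e₀, he₀⟩ := projBG_surjective x₀
  have hc : Continuous fun q : EG G × unitInterval =>
      projBG G (((contractionPath e₀).symm.trans (contractionPath q.1)) q.2) :=
    (projBG G).continuous.comp (Path.trans_continuous_family
      (fun _ => (contractionPath e₀).symm)
      ((contractionPath e₀).symm.continuous.comp continuous_snd) contractionPath
      continuous_contractionPath)
  let P : C(EG G, C(unitInterval, BG G)) := ContinuousMap.curry ⟨_, hc⟩
  have hP₀ : ∀ e, P e 0 = x₀ := fun e =>
    (congrArg (projBG G) (Path.source _)).trans he₀
  have hP₁ : ∀ e, P e 1 = projBG G e := fun e => congrArg (projBG G) (Path.target _)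
  refine ⟨⟨fun e => CompactCoherentification.mk _ ⟨P e, hP₀ e⟩, continuous_EG_iff.2 fun x => ?_⟩,
    hP₁⟩
  exact CompactCoherentification.continuous_rng_of_compactSpace.2
    ((P.continuous.comp (tupleMap x).continuous).subtype_mk _)

end

/-! ### From homotopy fixed points to sections -/

section

variable {G : Type u} [Group G]

theorem FinProb.ext_expect {X : Type*} {μ ν : FinProb X}
    (h : ∀ f : X → ℝ, μ.expect f = ν.expect f) : μ = ν := by
  classical
  refine StdSimplex.ext (Finsupp.ext fun x => ?_)
  have key : ∀ ρ : FinProb X, ρ.expect (fun y => if y = x then 1 else 0) =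
      StdSimplex.weights ρ x := fun ρ => by
    rw [← FinProb.weights_map_apply ρ (fun y => y) x]
    exact congr(StdSimplex.weights $(StdSimplex.map_id ρ) x)
  rw [← key, ← key, h]

theorem map_convexSum {ι : Type*} [Fintype ι] {X Y : Type*} (f : X → Y) (x : ι → X)
    (t : stdSimplex ℝ ι) : (convexSum x t).map f = convexSum (fun i => f (x i)) t :=
  StdSimplex.map_map _ _ _

theorem continuous_convexSum_fin {X : Type*} [TopologicalSpace X] (m : ℕ) :
    Continuous (Y := FinProb X)
      fun p : CompactCoherentification ((Fin m → X) × stdSimplex ℝ (Fin m)) =>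
        convexSum ((CompactCoherentification.mk _).symm p).1
          ((CompactCoherentification.mk _).symm p).2 :=
  continuous_iSup_rng (i := m) continuous_coinduced_rng

/-- A point of the standard simplex, with its coordinates renumbered. -/
def reindexSimplex {ι κ : Type*} [Fintype ι] [Fintype κ] (e : κ ≃ ι) (t : stdSimplex ℝ ι) :
    stdSimplex ℝ κ :=
  ⟨fun j => t (e j), fun _ => stdSimplex.zero_le t _,
    (Equiv.sum_comp e t).trans (stdSimplex.sum_eq_one t)⟩

theorem continuous_reindexSimplex {ι κ : Type*} [Fintype ι] [Fintype κ] (e : κ ≃ ι) :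
    Continuous (reindexSimplex e) := by
  refine Continuous.subtype_mk (continuous_pi fun j => ?_) _
  exact (continuous_apply (e j)).comp continuous_subtype_val

theorem convexSum_reindexSimplex {ι κ X : Type*} [Fintype ι] [Fintype κ] (e : κ ≃ ι) (x : ι → X)
    (t : stdSimplex ℝ ι) : convexSum (fun j => x (e j)) (reindexSimplex e t) = convexSum x t := by
  refine FinProb.ext_expect fun f => ?_
  rw [expect_convexSum, expect_convexSum]
  exact Equiv.sum_comp e fun i => t i * f (x i)

/-- On a compact space, convex combinations of points depend continuously on continuously varying
points and weights. -/
theorem continuous_convexSum {K : Type*} [TopologicalSpace K] [CompactSpace K] {ι : Type*}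
    [Fintype ι] {X : Type*} [TopologicalSpace X] {x : K → ι → X} {t : K → stdSimplex ℝ ι}
    (hx : ∀ i, Continuous fun k => x k i) (ht : Continuous t) :
    Continuous (Y := FinProb X) fun k => convexSum (x k) (t k) := by
  let e := (Fintype.equivFin ι).symm
  have hp : Continuous fun k => CompactCoherentification.mk
      ((Fin (Fintype.card ι) → X) × stdSimplex ℝ (Fin (Fintype.card ι)))
      (fun j => x k (e j), reindexSimplex e (t k)) :=
    CompactCoherentification.continuous_rng_of_compactSpace.2
      ((continuous_pi fun j => hx (e j)).prodMk ((continuous_reindexSimplex e).comp ht))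
  have hq := (continuous_convexSum_fin (X := X) _).comp hp
  have heq : (fun k => convexSum (x k) (t k)) = _ :=
    funext fun k => (convexSum_reindexSimplex e (x k) (t k)).symm
  rw [heq]
  exact hq

theorem FinProb.support_map_subset {X Y : Type*} [DecidableEq Y] (f : X → Y) (μ : FinProb X) :
    FinProb.support (StdSimplex.map f μ) ⊆ μ.support.image f :=
  Finsupp.mapDomain_support

/-- The image of a point `w` of the skeleton under a family of maps `V → X` depends continuously on
`w` and the maps, if the parameter space of the family is compact. -/
theorem continuous_map_skeleton {K : Type*} [TopologicalSpace K] [CompactSpace K]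
    [LocallyCompactSpace K] {V : Type v} {n : ℕ} {X : Type*} [TopologicalSpace X]
    {f : K → V → X} (hf : ∀ v, Continuous fun k => f k v) :
    Continuous (Y := FinProb X) fun q : SimplexSkeleton V n × K => q.1.1.map (f q.2) := by
  have hface : ∀ s : {s : Finset V // s.card ≤ n + 1},
      Continuous (Y := FinProb X) fun q : stdSimplex ℝ s.1 × K =>
        (faceInclusion s q.1).1.map (f q.2) := fun s => by
    have h := continuous_convexSum (K := stdSimplex ℝ s.1 × K) (x := fun q (v : s.1) => f q.2 v)
      (fun v => (hf v).comp continuous_snd) continuous_fst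
    have heq : (fun q : stdSimplex ℝ s.1 × K => (faceInclusion s q.1).1.map (f q.2)) = _ :=
      funext fun q => map_convexSum (f q.2) ((↑) : s.1 → V) q.1
    rw [heq]
    exact h
  have hw : ∀ w : SimplexSkeleton V n, Continuous (Y := FinProb X) fun k => w.1.map (f k) :=
    fun w => by
      obtain ⟨s, t, rfl⟩ : ∃ s t, faceInclusion s t = w := ⟨_, exists_faceInclusion_eq w⟩
      have h : Continuous fun k : K => (t, k) := by fun_prop
      have h' := (hface s).comp h
      exact h'
  -- Continuity on the product with the locally compact space `K` is continuity of the adjoint map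
  -- to the mapping space, which can be tested on the faces.
  let F : SimplexSkeleton V n → C(K, FinProb X) := fun w => ⟨_, hw w⟩
  have hF : Continuous F := continuous_iSup_dom.2 fun s => continuous_coinduced_dom.2
    (ContinuousMap.curry ⟨_, hface s⟩).continuous
  exact ContinuousMap.continuous_uncurry_of_continuous ⟨F, hF⟩

section

variable {x₀ : BG G} {n : ℕ} (Γ : C(EG G, BasedPaths (BG G) x₀))
  (φ : EG G → SimplexSkeleton G n)

/-- The measure on paths which gives the weight `φ(e)_g` to the path which belongs to `g⁻¹ e`. -/
def pathMeasure (e : EG G) : FinProb (BasedPaths (BG G) x₀) :=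
  StdSimplex.map (fun g : G => Γ (g⁻¹ • e)) (φ e).1

variable {φ}

theorem pathMeasure_smul (hφ : ∀ (g : G) (e : EG G), φ (g • e) = g • φ e) (g : G) (e : EG G) :
    pathMeasure Γ φ (g • e) = pathMeasure Γ φ e := by
  rw [pathMeasure, hφ]
  refine (StdSimplex.map_map (φ e).1 _ _).trans ?_
  simp only [mul_inv_rev, mul_smul, inv_smul_smul]
  rfl

theorem continuous_pathMeasure (hφ : Continuous φ) : Continuous (pathMeasure Γ φ) := by
  refine continuous_EG_iff.2 fun {m} x => ?_
  have h := continuous_map_skeleton (n := n)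
    (f := fun (t : stdSimplex ℝ (Fin (m.unop.len + 1))) (g : G) => Γ (g⁻¹ • tupleMap x t))
    fun g => Γ.continuous.comp ((continuous_const_smul g⁻¹).comp (tupleMap x).continuous)
  have h' : Continuous fun t : stdSimplex ℝ (Fin (m.unop.len + 1)) => (φ (tupleMap x t), t) :=
    (hφ.comp (tupleMap x).continuous).prodMk continuous_id
  have h'' := h.comp h'
  exact h''

theorem card_support_pathMeasure_le (e : EG G) : (pathMeasure Γ φ e).support.card ≤ n + 1 := by
  classical
  exact (Finset.card_le_card (FinProb.support_map_subset _ (φ e).1)).trans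
    (Finset.card_image_le.trans (φ e).2)

variable {Γ} in
theorem endpoint_of_mem_support_pathMeasure (hΓ : ∀ e, endpoint (Γ e) = projBG G e) {e : EG G}
    {γ : BasedPaths (BG G) x₀} (hγ : γ ∈ (pathMeasure Γ φ e).support) :
    endpoint γ = projBG G e := by
  classical
  obtain ⟨g, -, rfl⟩ := Finset.mem_image.1 (FinProb.support_map_subset _ (φ e).1 hγ)
  rw [hΓ, projBG_smul]

end

/-- The measures on paths depend only on the orbit, so that they form a section over `BG`. -/
theorem exists_section_of_equivariant {n : ℕ} {φ : C(EG G, SimplexSkeleton G n)}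
    (hφ : ∀ (g : G) (e : EG G), φ (g • e) = g • φ e) (x₀ : BG G) :
    ∃ s : C(BG G, FibFinProb (endpoint : BasedPaths (BG G) x₀ → BG G) (n + 1)),
      ∀ y, (s y).proj = y := by
  obtain ⟨Γ, hΓ⟩ := exists_continuous_basedPaths x₀
  let S : EG G → FibFinProb (endpoint : BasedPaths (BG G) x₀ → BG G) (n + 1) := fun e =>
    ⟨pathMeasure Γ φ e, card_support_pathMeasure_le Γ e, fun γ hγ γ' hγ' =>
      (endpoint_of_mem_support_pathMeasure hΓ hγ).trans
        (endpoint_of_mem_support_pathMeasure hΓ hγ').symm⟩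
  have hS : Continuous S := (continuous_pathMeasure Γ φ.continuous).subtype_mk _
  have hproj : ∀ e, (S e).proj = projBG G e := fun e => by
    obtain ⟨γ, hγ⟩ := (S e).1.support_nonempty
    exact ((S e).proj_eq hγ).trans (endpoint_of_mem_support_pathMeasure hΓ hγ)
  have hinv : ∀ e e', projBG G e = projBG G e' → S e = S e' := fun e e' h => by
    obtain ⟨g, rfl⟩ := projBG_eq_iff.1 h
    exact Subtype.ext (pathMeasure_smul Γ hφ g e')
  let s : BG G → FibFinProb (endpoint : BasedPaths (BG G) x₀ → BG G) (n + 1) := fun y =>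
    S (Function.surjInv projBG_surjective y)
  have hs : ∀ e, s (projBG G e) = S e := fun e => hinv _ _ (Function.surjInv_eq _ _)
  refine ⟨⟨s, isQuotientMap_projBG.continuous_iff.2 (hS.congr fun e => (hs e).symm)⟩, fun y => ?_⟩
  exact (hproj _).trans (Function.surjInv_eq _ _)

end

end AnalogCategory

end

/-- For every group `G` and every basepoint `x₀` of `BG`, the analog category of `G`, that is, of
`BG`, is the least `n` for which the `n`-skeleton of the simplex on `G` has a homotopy fixed
point; both sides are `∞` if there is no such `n`. -/
theorem proposition2p1 (G : Type u) [Group G] (x₀ : AnalogCategory.BG G) :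
    AnalogCategory.acat (AnalogCategory.BG G) x₀ =
      AnalogCategory.least fun n : ℕ =>
        Nonempty (AnalogCategory.HomotopyFixedPoints G (AnalogCategory.SimplexSkeleton G n)) := by
  refine congrArg AnalogCategory.least (funext fun n => propext ⟨?_, ?_⟩)
  · rintro ⟨s, hs⟩
    exact AnalogCategory.nonempty_homotopyFixedPoints_of_section hs
  · rintro ⟨φ⟩
    exact AnalogCategory.exists_section_of_equivariant
      ((CompactCoherentification.mk _).symm φ).2 x₀
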